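/- Let $F$ be a field of characteristic $2$. A quasilinear quadratic form over $F$ is a quadratic form $q$ on a finite-dimensional $F$-vector space $V_q$ such that $q(v+w)=q(v)+q(w)$ for all $v,w$; its dimension is $\dim V_q$. It is isotropic if $q(v)=0$ for some $v\neq 0$, and anisotropic otherwise; its isotropy index $\mathfrak{i}_0(q)$ is the maximal dimension of a totally isotropic subspace of $V_q$, and its anisotropic part $q_{an}$ is the form induced by $q$ on the quotient of $V_q$ by the subspace of all isotropic vectors. For a field extension $L/F$, $q_L$ denotes the scalar extension of $q$ to $V_q\otimes_F L$, and $q_{L(p)}$ means $(q_L)_{L(p_L)}$. The tensor product $p\otimes q$ is the quasilinear form on $V_p\otimes V_q$ with $(p\otimes q)(v\otimes w)=p(v)q(w)$. We write $p\subset q$ ($p$ is a subform of $q$) if $q\simeq p\perp r$ for some quadratic form $r$. If $p$ is anisotropic of dimension $\geq 2$ over a field, $F(p)$ denotes the function field of the projective quadric $\{p=0\}$ over that field $F$, and $p_1=(p_{F(p)})_{an}$. **Theorem.** Let $p$ and $q$ be anisotropic quasilinear quadratic forms of dimension $\geq 2$ over $F$ such that $q_{F(p)}$ is isotropic. Then there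 is a purely transcendental field extension $E/F$ such that $p_E$ is anisotropic and, writing $p_1=(p_{E(p)})_{an}$ for the form $p_1$ attached to $p_E$, there is an anisotropic quasilinear quadratic form $\tau$ over $E(p)$ with 1. $\dim(\tau)=\mathfrak{i}_0(q_{E(p)})$, and 2. $(p_1\otimes\tau)_{an}\subset (q_{E(p)})_{an}$. -/

import Mathlib

open scoped TensorProduct

universe u v w

/-- A quasilinear quadratic form on the `F`-vector space `V`: a quadratic form `q` with
`q (v + w) = q v + q w` for all `v`, `w`. -/
structure QuasilinearForm (F : Type*) (V : Type*) [Field F] [AddCommGroup V] [Module F V]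
    extends QuadraticMap F V F where
  map_add' : ∀ v w : V, toFun (v + w) = toFun v + toFun w

/-- `p` is a subform of `q`: there is a quadratic form `r` (on a finite-dimensional space, which up
to isometry is some `Fⁿ`) such that `q` is isometric to the orthogonal sum `p ⊥ r`. -/
def QuadraticMap.IsSubform {F V W : Type*} [Field F] [AddCommGroup V] [Module F V]
    [AddCommGroup W] [Module F W] (p : QuadraticForm F V) (q : QuadraticForm F W) : Prop :=
  ∃ (n : ℕ) (r : QuadraticForm F (Fin n → F)), QuadraticMap.Equivalent q (p.prod r)

/-- The isotropy index of a quadratic form: the largest dimension of a totally isotropic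
subspace. -/
noncomputable def QuadraticMap.isotropyIndex {F V : Type*} [Field F] [AddCommGroup V] [Module F V]
    (q : QuadraticForm F V) : ℕ :=
  sSup {n : ℕ | ∃ U : Submodule F V, Module.finrank F U = n ∧ ∀ v ∈ U, q v = 0}

/-- `E` is a purely transcendental extension of `F`: it is generated as a field by an
algebraically independent set. -/
def IsPurelyTranscendental (F E : Type*) [Field F] [Field E] [Algebra F E] : Prop :=
  ∃ s : Set E, AlgebraicIndependent F ((↑) : s → E) ∧ IntermediateField.adjoin F s = ⊤

namespace QuasilinearForm

section Basic

variable {F : Type u} {V : Type v} {W : Type w} [Field F] [AddCommGroup V] [Module F V]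
  [AddCommGroup W] [Module F W]

/-- An additive map which is homogeneous of degree `2` is a quasilinear quadratic form. -/
def ofAddMonoidHom (f : V →+ F) (hf : ∀ (a : F) (v : V), f (a • v) = (a * a) * f v) :
    QuasilinearForm F V where
  toFun := f
  toFun_smul := fun a v => by rw [hf, smul_eq_mul]
  exists_companion' := ⟨0, fun v w => by simp⟩
  map_add' := map_add f

/-- A quasilinear quadratic form as an additive map. -/
def toAddMonoidHom (q : QuasilinearForm F V) : V →+ F :=
  AddMonoidHom.mk' q.toQuadraticMap q.map_add'

@[simp]
theorem toAddMonoidHom_apply (q : QuasilinearForm F V) (v : V) :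
    q.toAddMonoidHom v = q.toQuadraticMap v := rfl

theorem ofAddMonoidHom_apply (f : V →+ F) (hf : ∀ (a : F) (v : V), f (a • v) = (a * a) * f v)
    (v : V) : (ofAddMonoidHom f hf).toQuadraticMap v = f v := rfl

theorem add_apply (q : QuasilinearForm F V) (v w : V) :
    q.toQuadraticMap (v + w) = q.toQuadraticMap v + q.toQuadraticMap w := q.map_add' v w

theorem smul_apply (q : QuasilinearForm F V) (a : F) (v : V) :
    q.toQuadraticMap (a • v) = (a * a) * q.toQuadraticMap v := by
  rw [QuadraticMap.map_smul, smul_eq_mul]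

theorem sum_apply (q : QuasilinearForm F V) {ι : Type*} (s : Finset ι) (f : ι → V) :
    q.toQuadraticMap (∑ i ∈ s, f i) = ∑ i ∈ s, q.toQuadraticMap (f i) :=
  map_sum q.toAddMonoidHom f s

/-- Doubled values vanish (so that a nonzero quasilinear form forces characteristic `2`). -/
theorem two_mul_apply (q : QuasilinearForm F V) (v : V) : 2 * q.toQuadraticMap v = 0 := by
  have h1 := q.add_apply v v
  have h2 := q.smul_apply 2 v
  rw [two_smul, h1] at h2
  linear_combination -h2

/-- A quasilinear form is anisotropic if it has no nonzero isotropic vector. -/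
abbrev Anisotropic (q : QuasilinearForm F V) : Prop := q.toQuadraticMap.Anisotropic

/-- A quasilinear form is isotropic if it has a nonzero isotropic vector. -/
abbrev Isotropic (q : QuasilinearForm F V) : Prop := ∃ v : V, v ≠ 0 ∧ q.toQuadraticMap v = 0

/-- The isotropy index of a quasilinear form. -/
noncomputable abbrev isotropyIndex (q : QuasilinearForm F V) : ℕ := q.toQuadraticMap.isotropyIndex

/-- The subform relation between quasilinear forms. -/
abbrev IsSubform (p : QuasilinearForm F V) (q : QuasilinearForm F W) : Prop :=
  p.toQuadraticMap.IsSubform q.toQuadraticMap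

/-- The subspace of all isotropic vectors. -/
def isotropicSubspace (q : QuasilinearForm F V) : Submodule F V where
  carrier := {v | q.toQuadraticMap v = 0}
  zero_mem' := QuadraticMap.map_zero _
  add_mem' {v w} hv hw := by
    have hv' : q.toQuadraticMap v = 0 := hv
    have hw' : q.toQuadraticMap w = 0 := hw
    change q.toQuadraticMap (v + w) = 0
    rw [q.add_apply, hv', hw', add_zero]
  smul_mem' a v hv := by
    have hv' : q.toQuadraticMap v = 0 := hv
    change q.toQuadraticMap (a • v) = 0
    rw [q.smul_apply, hv', mul_zero]

theorem isotropyIndex_eq [FiniteDimensional F V] (q : QuasilinearForm F V) :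
    q.isotropyIndex = Module.finrank F q.isotropicSubspace := by
  refine IsGreatest.csSup_eq ⟨⟨_, rfl, fun v hv => hv⟩, ?_⟩
  rintro n ⟨U, rfl, hU⟩
  exact Submodule.finrank_mono fun v hv => hU v hv

/-- The anisotropic part of a quasilinear form: the form induced on the quotient by the subspace of
isotropic vectors. -/
def anisotropicPart (q : QuasilinearForm F V) : QuasilinearForm F (V ⧸ q.isotropicSubspace) :=
  ofAddMonoidHom
    (QuotientAddGroup.lift q.isotropicSubspace.toAddSubgroup q.toAddMonoidHom fun _ hv => hv)
    (by
      intro a v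
      obtain ⟨v, rfl⟩ := Submodule.mkQ_surjective _ v
      exact q.smul_apply a v)

@[simp]
theorem anisotropicPart_mk (q : QuasilinearForm F V) (v : V) :
    q.anisotropicPart.toQuadraticMap (Submodule.Quotient.mk v) = q.toQuadraticMap v := rfl

theorem anisotropicPart_anisotropic (q : QuasilinearForm F V) : q.anisotropicPart.Anisotropic := by
  intro v hv
  obtain ⟨v, rfl⟩ := Submodule.mkQ_surjective _ v
  exact (Submodule.Quotient.mk_eq_zero _).2 hv

/-- The scalar extension `q_L` of a quasilinear form, on the `L`-vector space `L ⊗ V`; it is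
determined by `q_L (l ⊗ v) = l² q(v)` and additivity. -/
noncomputable def baseChange (q : QuasilinearForm F V) (L : Type*) [Field L] [Algebra F L] :
    QuasilinearForm L (L ⊗[F] V) :=
  ofAddMonoidHom
    (TensorProduct.liftAddHom
      (AddMonoidHom.mk'
        (fun l : L => ((AddMonoidHom.mulLeft (l * l)).comp
          (algebraMap F L).toAddMonoidHom).comp q.toAddMonoidHom)
        (by
          intro l m
          ext v
          have h := congrArg (algebraMap F L) (q.two_mul_apply v)
          simp only [map_mul, map_ofNat, map_zero] at h
          change (l + m) * (l + m) * algebraMap F L (q.toQuadraticMap v)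
            = l * l * algebraMap F L (q.toQuadraticMap v)
              + m * m * algebraMap F L (q.toQuadraticMap v)
          linear_combination l * m * h))
      (by
        intro a l v
        change (a • l) * (a • l) * algebraMap F L (q.toQuadraticMap v)
          = l * l * algebraMap F L (q.toQuadraticMap (a • v))
        rw [q.smul_apply, Algebra.smul_def, map_mul, map_mul]
        ring))
    (by
      intro a t
      induction t with
      | zero => simp
      | add s t hs ht => rw [smul_add, map_add, map_add, hs, ht, mul_add]
      | tmul l v =>
        rw [TensorProduct.smul_tmul']
        change (a * l) * (a * l) * algebraMap F L (q.toQuadraticMap v)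
          = a * a * (l * l * algebraMap F L (q.toQuadraticMap v))
        ring)

@[simp]
theorem baseChange_tmul (q : QuasilinearForm F V) (L : Type*) [Field L] [Algebra F L] (l : L)
    (v : V) : (q.baseChange L).toQuadraticMap (l ⊗ₜ[F] v)
      = l * l * algebraMap F L (q.toQuadraticMap v) := rfl

/-- The tensor product of two quasilinear forms; it is determined by `(p ⊗ q)(v ⊗ w) = p(v) q(w)`
and additivity. -/
noncomputable def tensor (p : QuasilinearForm F V) (q : QuasilinearForm F W) :
    QuasilinearForm F (V ⊗[F] W) :=
  ofAddMonoidHom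
    (TensorProduct.liftAddHom
      (AddMonoidHom.mk'
        (fun v : V => (AddMonoidHom.mulLeft (p.toQuadraticMap v)).comp q.toAddMonoidHom)
        (by
          intro v v'
          ext w
          change p.toQuadraticMap (v + v') * q.toQuadraticMap w
            = p.toQuadraticMap v * q.toQuadraticMap w + p.toQuadraticMap v' * q.toQuadraticMap w
          rw [p.add_apply, add_mul]))
      (by
        intro a v w
        change p.toQuadraticMap (a • v) * q.toQuadraticMap w
          = p.toQuadraticMap v * q.toQuadraticMap (a • w)
        rw [p.smul_apply, q.smul_apply]
        ring))
    (by
      intro a t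
      induction t with
      | zero => simp
      | add s t hs ht => rw [smul_add, map_add, map_add, hs, ht, mul_add]
      | tmul v w =>
        rw [TensorProduct.smul_tmul']
        change p.toQuadraticMap (a • v) * q.toQuadraticMap w
          = a * a * (p.toQuadraticMap v * q.toQuadraticMap w)
        rw [p.smul_apply]
        ring)

@[simp]
theorem tensor_tmul (p : QuasilinearForm F V) (q : QuasilinearForm F W) (v : V) (w : W) :
    (p.tensor q).toQuadraticMap (v ⊗ₜ[F] w) = p.toQuadraticMap v * q.toQuadraticMap w := rfl

end Basic

section FunctionField

/-- The homogeneous polynomial `∑ aᵢ Xᵢ²`. -/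
noncomputable def diagonalPolynomial {F : Type u} [Field F] {n : ℕ} (a : Fin n → F) :
    MvPolynomial (Fin n) F :=
  ∑ i, MvPolynomial.C (a i) * MvPolynomial.X i ^ 2

theorem irreducible_diagonalPolynomial {F : Type u} [Field F] {n : ℕ} (hn : 2 ≤ n) (a : Fin n → F)
    (ha : ∀ x : Fin n → F, ∑ i, a i * x i ^ 2 = 0 → x = 0) :
    Irreducible (diagonalPolynomial a) := by
  obtain ⟨m, rfl⟩ : ∃ m, n = m + 2 := ⟨n - 2, by omega⟩
  have ha0 : a 0 ≠ 0 := by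
    intro h
    have h1 := ha (Pi.single 0 1) (by
      rw [Finset.sum_eq_single 0]
      · simp [h]
      · intro i _ hi
        simp [Pi.single_eq_of_ne hi]
      · simp)
    have h2 := congrFun h1 0
    simp at h2
  set c : MvPolynomial (Fin (m + 1)) F :=
    ∑ i : Fin (m + 1), MvPolynomial.C ((a 0)⁻¹ * a i.succ) * MvPolynomial.X i ^ 2 with hc
  have key : MvPolynomial.finSuccEquiv F (m + 1) (diagonalPolynomial a)
      = Polynomial.C (MvPolynomial.C (a 0)) * (Polynomial.X ^ 2 + Polynomial.C c) := by
    rw [diagonalPolynomial, Fin.sum_univ_succ, map_add, map_mul, map_pow,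
      MvPolynomial.finSuccEquiv_X_zero, map_sum, mul_add, hc, map_sum, Finset.mul_sum]
    have hC : ∀ b : F, MvPolynomial.finSuccEquiv F (m + 1) (MvPolynomial.C b)
        = Polynomial.C (MvPolynomial.C b) := fun b => by
      simp [MvPolynomial.finSuccEquiv_apply]
    rw [hC]
    congr 1
    refine Finset.sum_congr rfl fun i _ => ?_
    rw [map_mul, map_pow, hC, MvPolynomial.finSuccEquiv_X_succ, ← map_pow, ← map_mul, ← map_mul,
      ← mul_assoc, ← map_mul, ← mul_assoc, mul_inv_cancel₀ ha0, one_mul]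
  rw [← MulEquiv.irreducible_iff (MvPolynomial.finSuccEquiv F (m + 1)), key]
  have hu : IsUnit (Polynomial.C (MvPolynomial.C (σ := Fin (m + 1)) (a 0))) :=
    ((IsUnit.mk0 _ ha0).map MvPolynomial.C).map Polynomial.C
  rw [irreducible_isUnit_mul hu]
  have hm : (Polynomial.X ^ 2 + Polynomial.C c : Polynomial _).Monic :=
    Polynomial.monic_X_pow_add_C c two_ne_zero
  rw [hm.irreducible_iff_roots_eq_zero_of_degree_le_three
    (by rw [Polynomial.natDegree_X_pow_add_C]) (by rw [Polynomial.natDegree_X_pow_add_C]; norm_num)]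
  rw [Multiset.eq_zero_iff_forall_notMem]
  intro r hr
  have hr' := Polynomial.isRoot_of_mem_roots hr
  simp only [Polynomial.IsRoot.def, Polynomial.eval_add, Polynomial.eval_pow, Polynomial.eval_X,
    Polynomial.eval_C] at hr'
  have he := congrArg (MvPolynomial.eval (Pi.single 0 1 : Fin (m + 1) → F)) hr'
  have hce : MvPolynomial.eval (Pi.single 0 1 : Fin (m + 1) → F) c = (a 0)⁻¹ * a 1 := by
    rw [hc, map_sum, Finset.sum_eq_single 0]
    · simp
    · intro i _ hi
      simp [Pi.single_eq_of_ne hi]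
    · simp
  rw [map_add, map_pow, map_zero, hce] at he
  set t := MvPolynomial.eval (Pi.single 0 1 : Fin (m + 1) → F) r
  have h1 := ha (Fin.cons t (Pi.single 0 1)) (by
    rw [Fin.sum_univ_succ, Finset.sum_eq_single 0]
    · have h2 : a 0 * (t ^ 2 + (a 0)⁻¹ * a 1) = 0 := by rw [he, mul_zero]
      rw [mul_add, ← mul_assoc, mul_inv_cancel₀ ha0, one_mul] at h2
      simpa using h2
    · intro i _ hi
      simp [Pi.single_eq_of_ne hi]
    · simp)
  have h2 := congrFun h1 (Fin.succ 0)
  simp at h2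

variable {F : Type u} {V : Type v} [Field F] [AddCommGroup V] [Module F V] [FiniteDimensional F V]

/-- The form `p` as a homogeneous polynomial of degree `2` in coordinates with respect to a basis
`b` of `V`; for quasilinear `p` this is `∑ p(bᵢ) Xᵢ²`. -/
noncomputable def polynomial (p : QuasilinearForm F V) :
    MvPolynomial (Fin (Module.finrank F V)) F :=
  diagonalPolynomial fun i => p.toQuadraticMap (Module.finBasis F V i)

theorem eval_polynomial (p : QuasilinearForm F V) (v : V) :
    MvPolynomial.eval ((Module.finBasis F V).repr v) p.polynomial = p.toQuadraticMap v := by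
  conv_rhs => rw [← (Module.finBasis F V).sum_repr v]
  simp only [polynomial, diagonalPolynomial, map_sum, map_mul, map_pow, MvPolynomial.eval_C,
    MvPolynomial.eval_X, sum_apply, smul_apply]
  exact Finset.sum_congr rfl fun i _ => by ring

theorem irreducible_polynomial (p : QuasilinearForm F V) (hp : p.Anisotropic)
    (hdim : 2 ≤ Module.finrank F V) : Irreducible p.polynomial := by
  refine irreducible_diagonalPolynomial hdim _ fun x hx => ?_
  have h : p.toQuadraticMap (∑ i, x i • Module.finBasis F V i) = 0 := by
    rw [sum_apply, ← hx]
    exact Finset.sum_congr rfl fun i _ => by rw [smul_apply]; ring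
  have h2 := hp _ h
  funext i
  exact Fintype.linearIndependent_iff.1 (Module.finBasis F V).linearIndependent x h2 i

/-- The homogeneous coordinate ring `F[X₁, …, Xₙ]/(p)` of the projective quadric `p = 0`, that is,
the coordinate ring of its affine cone. -/
abbrev CoordinateRing (p : QuasilinearForm F V) : Type u :=
  MvPolynomial (Fin (Module.finrank F V)) F ⧸ Ideal.span {p.polynomial}

theorem isDomain_coordinateRing (p : QuasilinearForm F V) (hp : p.Anisotropic)
    (hdim : 2 ≤ Module.finrank F V) : IsDomain p.CoordinateRing := by
  have h := p.irreducible_polynomial hp hdim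
  rw [Ideal.Quotient.isDomain_iff_prime, Ideal.span_singleton_prime h.ne_zero]
  exact h.prime

/-- The function field `F[p]` of the affine cone `p = 0`, for an anisotropic form `p` of dimension
at least `2`: the fraction field of the coordinate ring. -/
def AffineFunctionField (p : QuasilinearForm F V) (_hp : p.Anisotropic)
    (_hdim : 2 ≤ Module.finrank F V) : Type u :=
  FractionRing p.CoordinateRing

noncomputable instance (p : QuasilinearForm F V) (hp : p.Anisotropic)
    (hdim : 2 ≤ Module.finrank F V) : Field (p.AffineFunctionField hp hdim) :=
  letI := p.isDomain_coordinateRing hp hdim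
  inferInstanceAs (Field (FractionRing p.CoordinateRing))

noncomputable instance (p : QuasilinearForm F V) (hp : p.Anisotropic)
    (hdim : 2 ≤ Module.finrank F V) : Algebra p.CoordinateRing (p.AffineFunctionField hp hdim) :=
  inferInstanceAs (Algebra p.CoordinateRing (FractionRing p.CoordinateRing))

instance (p : QuasilinearForm F V) (hp : p.Anisotropic) (hdim : 2 ≤ Module.finrank F V) :
    IsFractionRing p.CoordinateRing (p.AffineFunctionField hp hdim) :=
  inferInstanceAs (IsFractionRing p.CoordinateRing (FractionRing p.CoordinateRing))

noncomputable instance (p : QuasilinearForm F V) (hp : p.Anisotropic)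
    (hdim : 2 ≤ Module.finrank F V) : Algebra F (p.AffineFunctionField hp hdim) :=
  ((algebraMap p.CoordinateRing (p.AffineFunctionField hp hdim)).comp
    (algebraMap F p.CoordinateRing)).toAlgebra

instance (p : QuasilinearForm F V) (hp : p.Anisotropic) (hdim : 2 ≤ Module.finrank F V) :
    IsScalarTower F p.CoordinateRing (p.AffineFunctionField hp hdim) :=
  IsScalarTower.of_algebraMap_eq (R := F) (S := p.CoordinateRing)
    (A := p.AffineFunctionField hp hdim) fun _ => rfl

/-- The image of the `i`-th coordinate in the function field of the affine cone. -/
noncomputable def coordinate (p : QuasilinearForm F V) (hp : p.Anisotropic)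
    (hdim : 2 ≤ Module.finrank F V) (i : Fin (Module.finrank F V)) :
    p.AffineFunctionField hp hdim :=
  algebraMap p.CoordinateRing _ (Ideal.Quotient.mk _ (MvPolynomial.X i))

/-- The function field `F(p)` of the projective quadric `p = 0`, for an anisotropic form `p` of
dimension at least `2`: the subfield of the function field of the affine cone consisting of the
homogeneous fractions of degree `0`, which is the subfield generated over `F` by the ratios of
homogeneous coordinates. -/
noncomputable def functionField (p : QuasilinearForm F V) (hp : p.Anisotropic)
    (hdim : 2 ≤ Module.finrank F V) : IntermediateField F (p.AffineFunctionField hp hdim) :=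
  IntermediateField.adjoin F
    {z | ∃ i j, z = p.coordinate hp hdim i / p.coordinate hp hdim j}

/-- The first higher anisotropic kernel `p₁` of an anisotropic form `p` of dimension at least `2`:
the anisotropic part of `p` over its own function field. -/
noncomputable def firstKernel (p : QuasilinearForm F V) (hp : p.Anisotropic)
    (hdim : 2 ≤ Module.finrank F V) :
    QuasilinearForm (p.functionField hp hdim)
      ((p.functionField hp hdim ⊗[F] V) ⧸
        (p.baseChange (p.functionField hp hdim)).isotropicSubspace) :=
  (p.baseChange (p.functionField hp hdim)).anisotropicPart

theorem two_le_finrank_baseChange (hdim : 2 ≤ Module.finrank F V) (E : Type*) [Field E]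
    [Algebra F E] : 2 ≤ Module.finrank E (E ⊗[F] V) := by
  rwa [Module.finrank_baseChange]

end FunctionField

end QuasilinearForm

/-!
The idea is to differentiate isotropic vectors of `q` over the generic point of the cone `p = 0`.

An isotropic vector of `q` over the function field of the cone is, up to a scalar, the class of a
vector `f` of polynomials with `q(f) = p h` for a polynomial `h`. Substitute `x + Y s` for the
variables, where `x` is the generic point of the cone and `s` any direction. As `p` is additive and
`p(x) = 0`, the right hand side becomes `Y² p(s) h(x + Y s)`; as `q` is additive, the coefficient of
`Y²` on the left hand side is `q(D_s f)`, where `D_s` is the derivation with `D_s x = s`, which exists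
on the function field because `p` has no partial derivatives in characteristic `2`. Hence
`q(D_s f) = p(s) h(x)` for all `s` at once (`sum_mul_coneDerivation_sq_of_eq`). So `h(x)`, the residue
of `f`, multiplies every value of `p` into a value of `q`. If the residue vanishes, then `p²` divides
`q(f)`, and reduction modulo `p` in one variable shows that `p` divides `f`, as `q` is anisotropic over
polynomial rings (`MvPolynomial.dvd_of_sq_dvd_sum_C_mul_sq`). By the Leibniz rule the residue is
quadratic on isotropic vectors, so it is an anisotropic quasilinear form on the isotropic subspace of
`q`, whose dimension is the isotropy index. Scaling the directions by a coordinate makes the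
derivations preserve the function field of the projective quadric, so the same holds there
(`residueForm`, `residueForm_spec`). This form is `τ`.

For anisotropic quasilinear forms, being a subform is the same as inclusion of the sets of values
(`isSubform_of_forall_exists`), which turns the relation of values into the subform statement.

The argument takes place over `F(p)`, so that no variables have to be adjoined to `F`: the theorem is
obtained for the purely transcendental extension of degree zero. When `q` stays anisotropic over
`F(p)`, the form `τ` is zero-dimensional.
-/

/-! ### Diagonal forms over polynomial rings in characteristic two -/

/-- If a diagonal sum of squares is divisible by `Q ^ 2` with `Q` quadratic, then so is the sum formed
from the remainders modulo `Q`; the latter has degree at most `2`, hence vanishes. -/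
theorem Polynomial.sum_C_mul_modByMonic_sq_eq_zero {R ι : Type*} [CommRing R] [IsDomain R]
    [CharP R 2] [Fintype ι] {Q : Polynomial R} (hQm : Q.Monic) (hQd : Q.natDegree = 2) (b : ι → R)
    (g : ι → Polynomial R) (h : Q ^ 2 ∣ ∑ j, C (b j) * g j ^ 2) :
    ∑ j, C (b j) * (g j %ₘ Q) ^ 2 = 0 := by
  have hdvd : Q ^ 2 ∣ ∑ j, C (b j) * (g j %ₘ Q) ^ 2 := by
    have h3 : Q ^ 2 ∣ ∑ j, C (b j) * (Q * (g j /ₘ Q)) ^ 2 :=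
      Finset.dvd_sum fun j _ => Dvd.dvd.mul_left (by rw [mul_pow]; exact dvd_mul_right _ _) _
    have h4 : ∑ j, C (b j) * g j ^ 2
        = ∑ j, C (b j) * (g j %ₘ Q) ^ 2 + ∑ j, C (b j) * (Q * (g j /ₘ Q)) ^ 2 := by
      rw [← Finset.sum_add_distrib]
      refine Finset.sum_congr rfl fun j _ => ?_
      rw [← mul_add, ← CharTwo.add_sq, modByMonic_add_div]
    have h5 := dvd_sub h h3
    rwa [h4, add_sub_cancel_right] at h5
  have hrd : ∀ j, (g j %ₘ Q).natDegree ≤ 1 := fun j => by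
    have h := natDegree_modByMonic_lt (g j) hQm (fun h => by
      rw [h, natDegree_one] at hQd; omega)
    rw [hQd] at h
    exact Nat.lt_succ_iff.1 h
  refine eq_zero_of_dvd_of_natDegree_lt hdvd ?_
  rw [hQm.natDegree_pow, hQd]
  refine (natDegree_sum_le_of_forall_le (n := 2) _ _ fun j _ => ?_).trans_lt (by norm_num)
  refine (natDegree_C_mul_le _ _).trans (natDegree_pow_le.trans ?_)
  have := hrd j
  omega

namespace MvPolynomial

variable {F : Type*} [Field F] [CharP F 2]

theorem coeff_two_smul_sq {σ : Type*} (f : MvPolynomial σ F) (m : σ →₀ ℕ) :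
    coeff (2 • m) (f ^ 2) = coeff m f ^ 2 := by
  rw [← map_frobenius_expand (p := 2), coeff_map, coeff_expand_smul 2 two_ne_zero, frobenius_def]

/-- An anisotropic diagonal form in characteristic `2` stays anisotropic over a polynomial ring: look
at the coefficients of squares of monomials. -/
theorem eq_zero_of_sum_C_mul_sq_eq_zero {σ ι : Type*} [Fintype ι] {b : ι → F}
    (hb : ∀ c : ι → F, ∑ j, b j * c j ^ 2 = 0 → c = 0) {f : ι → MvPolynomial σ F}
    (hf : ∑ j, C (b j) * f j ^ 2 = 0) (j : ι) : f j = 0 := by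
  ext m
  refine congrFun (hb (fun j => coeff m (f j)) ?_) j
  have h := congrArg (coeff (2 • m)) hf
  simpa [coeff_sum, coeff_C_mul, coeff_two_smul_sq] using h

open QuasilinearForm in
/-- If an anisotropic diagonal form takes on polynomials `f j` a value divisible by the square of
`∑ a i X i ^ 2`, then every `f j` is divisible by `∑ a i X i ^ 2`. The polynomial is regarded as a
quadratic polynomial in the first variable. -/
theorem dvd_of_sq_dvd_sum_C_mul_sq {ι : Type*} [Fintype ι] {n : ℕ} (hn : 0 < n)
    {a : Fin n → F} (ha' : ∀ i, a i ≠ 0) {b : ι → F}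
    (hb : ∀ c : ι → F, ∑ j, b j * c j ^ 2 = 0 → c = 0) {f : ι → MvPolynomial (Fin n) F}
    (hf : diagonalPolynomial a ^ 2 ∣ ∑ j, C (b j) * f j ^ 2) (j : ι) :
    diagonalPolynomial a ∣ f j := by
  obtain ⟨n, rfl⟩ : ∃ m, n = m + 1 := ⟨n - 1, by omega⟩
  have ha := ha' 0
  let e := finSuccEquiv F n
  have hC : ∀ b : F, e (C b) = Polynomial.C (C b) := fun b => by
    simp [e, finSuccEquiv_apply]
  obtain ⟨c, hc⟩ : ∃ c : MvPolynomial (Fin n) F,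
      c = ∑ i : Fin n, C ((a 0)⁻¹ * a i.succ) * X i ^ 2 := ⟨_, rfl⟩
  obtain ⟨Q, hQ⟩ : ∃ Q : Polynomial (MvPolynomial (Fin n) F),
    Q = Polynomial.X ^ 2 + Polynomial.C c := ⟨_, rfl⟩
  have key : e (diagonalPolynomial a) = Polynomial.C (C (a 0)) * Q := by
    rw [diagonalPolynomial, Fin.sum_univ_succ, map_add, map_mul, map_pow,
      finSuccEquiv_X_zero, map_sum, hQ, mul_add, hc, map_sum, Finset.mul_sum, hC]
    congr 1
    refine Finset.sum_congr rfl fun i _ => ?_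
    rw [map_mul, map_pow, hC, finSuccEquiv_X_succ, ← map_pow, ← map_mul, ← map_mul,
      ← mul_assoc, ← map_mul, ← mul_assoc, mul_inv_cancel₀ ha, one_mul]
  have hQm : Q.Monic := hQ ▸ Polynomial.monic_X_pow_add_C c two_ne_zero
  have hQd : Q.natDegree = 2 := hQ ▸ Polynomial.natDegree_X_pow_add_C
  have hu : IsUnit (Polynomial.C (C (σ := Fin n) (a 0))) :=
    ((IsUnit.mk0 _ ha).map C).map Polynomial.C
  have hdvd : Q ^ 2 ∣ ∑ j, Polynomial.C (C (b j)) * e (f j) ^ 2 := by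
    have h := map_dvd e hf
    rw [map_pow, key, mul_pow, (hu.pow 2).mul_left_dvd] at h
    simpa only [map_sum, map_mul, map_pow, hC] using h
  have hzero := Polynomial.sum_C_mul_modByMonic_sq_eq_zero hQm hQd (fun j => C (b j))
    (fun j => e (f j)) hdvd
  have hsymm : ∑ j, C (b j) * e.symm (e (f j) %ₘ Q) ^ 2 = 0 := by
    apply e.injective
    simpa only [map_sum, map_mul, map_pow, hC, AlgEquiv.apply_symm_apply, map_zero] using hzero
  have hr : e (f j) %ₘ Q = 0 := by
    have h := eq_zero_of_sum_C_mul_sq_eq_zero hb hsymm j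
    rwa [map_eq_zero_iff e.symm e.symm.injective] at h
  rw [← map_dvd_iff e, key, hu.mul_left_dvd]
  exact (Polynomial.modByMonic_eq_zero_iff_dvd hQm).1 hr

end MvPolynomial

namespace QuasilinearForm

/-! ### Displacing the generic point of the affine cone -/

section Deformation

open MvPolynomial

variable {F : Type u} {V : Type v} [Field F] [AddCommGroup V] [Module F V] [FiniteDimensional F V]
  (p : QuasilinearForm F V) (hp : p.Anisotropic) (hdim : 2 ≤ Module.finrank F V)

/-- The coefficients of the diagonal form of `p` in the basis used for `p.polynomial`. -/
noncomputable def coeffs (i : Fin (Module.finrank F V)) : F :=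
  p.toQuadraticMap (Module.finBasis F V i)

theorem polynomial_eq : p.polynomial = diagonalPolynomial p.coeffs := rfl

/-- Evaluation of polynomials at the generic point of the affine cone `p = 0`. -/
noncomputable def evalGeneric :
    MvPolynomial (Fin (Module.finrank F V)) F →ₐ[F] p.AffineFunctionField hp hdim :=
  aeval (p.coordinate hp hdim)

theorem evalGeneric_eq (f : MvPolynomial (Fin (Module.finrank F V)) F) :
    p.evalGeneric hp hdim f
      = algebraMap p.CoordinateRing (p.AffineFunctionField hp hdim) (Ideal.Quotient.mk _ f) := by
  have h : p.evalGeneric hp hdim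
      = (IsScalarTower.toAlgHom F p.CoordinateRing (p.AffineFunctionField hp hdim)).comp
        (Ideal.Quotient.mkₐ F _) := by
    ext i
    simp [evalGeneric, coordinate]
  rw [h]
  rfl

theorem evalGeneric_eq_zero_iff (f : MvPolynomial (Fin (Module.finrank F V)) F) :
    p.evalGeneric hp hdim f = 0 ↔ p.polynomial ∣ f := by
  let _ := p.isDomain_coordinateRing hp hdim
  rw [evalGeneric_eq, map_eq_zero_iff _ (IsFractionRing.injective p.CoordinateRing
    (p.AffineFunctionField hp hdim)), Ideal.Quotient.eq_zero_iff_mem, Ideal.mem_span_singleton]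

theorem exists_common_denominator {ι : Type*} [Finite ι] (w : ι → p.AffineFunctionField hp hdim) :
    ∃ (d : p.AffineFunctionField hp hdim) (f : ι → MvPolynomial (Fin (Module.finrank F V)) F),
      d ≠ 0 ∧ ∀ j, p.evalGeneric hp hdim (f j) = d * w j := by
  let _ := p.isDomain_coordinateRing hp hdim
  obtain ⟨d, hd⟩ := IsLocalization.exist_integer_multiples_of_finite
    (nonZeroDivisors p.CoordinateRing) w
  choose r hr using hd
  choose f hf using fun j => Ideal.Quotient.mk_surjective (r j)
  refine ⟨algebraMap _ _ d.1, f, ?_, fun j => ?_⟩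
  · exact IsFractionRing.to_map_ne_zero_of_mem_nonZeroDivisors d.2
  · rw [evalGeneric_eq, hf, hr, Algebra.smul_def]

theorem coeffs_ne_zero (hp : p.Anisotropic) (i : Fin (Module.finrank F V)) : p.coeffs i ≠ 0 :=
  fun h => (Module.finBasis F V).ne_zero i (hp _ h)

theorem coordinate_ne_zero (i : Fin (Module.finrank F V)) : p.coordinate hp hdim i ≠ 0 := by
  intro h
  have hdvd : p.polynomial ∣ X i := by
    rw [← p.evalGeneric_eq_zero_iff hp hdim]
    simpa [evalGeneric] using h
  -- Being prime, `X i` would then divide the polynomial of `p`, which has a value at a basis vector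
  -- other than the `i`-th.
  have hdvd' : X i ∣ p.polynomial :=
    ((p.irreducible_polynomial hp hdim).associated_of_dvd (X_prime (i := i)).irreducible hdvd).symm.dvd
  have : Nontrivial (Fin (Module.finrank F V)) := Fin.nontrivial_iff_two_le.2 hdim
  obtain ⟨k, hk⟩ := exists_ne i
  obtain ⟨g, hg⟩ := hdvd'
  have h1 := congrArg (eval ((Module.finBasis F V).repr (Module.finBasis F V k))) hg
  rw [eval_polynomial, map_mul, eval_X, Module.Basis.repr_self, Finsupp.single_eq_of_ne hk.symm,
    zero_mul] at h1
  exact p.coeffs_ne_zero hp k h1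

theorem sum_coeffs_mul_coordinate_sq :
    ∑ i, algebraMap F _ (p.coeffs i) * p.coordinate hp hdim i ^ 2 = 0 := by
  have h := (p.evalGeneric_eq_zero_iff hp hdim p.polynomial).2 dvd_rfl
  simpa [polynomial, diagonalPolynomial, evalGeneric, coeffs] using h

/-- The first-order displacement of the generic point `x` of the affine cone to `x + ε s`. -/
noncomputable def displacement (s : Fin (Module.finrank F V) → p.AffineFunctionField hp hdim) :
    MvPolynomial (Fin (Module.finrank F V)) F →ₐ[F] DualNumber (p.AffineFunctionField hp hdim) :=
  aeval fun i => TrivSqZeroExt.inl (p.coordinate hp hdim i) + TrivSqZeroExt.inr (s i)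

variable (s : Fin (Module.finrank F V) → p.AffineFunctionField hp hdim)

theorem fst_displacement (f : MvPolynomial (Fin (Module.finrank F V)) F) :
    (p.displacement hp hdim s f).fst = p.evalGeneric hp hdim f := by
  have h : (TrivSqZeroExt.fstHom F (p.AffineFunctionField hp hdim) _).comp
      (p.displacement hp hdim s) = p.evalGeneric hp hdim := by
    ext i
    simp [displacement, evalGeneric]
  exact DFunLike.congr_fun h f

/-- The substitution `X i ↦ x i + s i Y` of the line through the generic point `x` with direction `s`,
with values in polynomials in `Y`. Unlike `displacement` it retains the second-order terms. -/
noncomputable def lineEval :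
    MvPolynomial (Fin (Module.finrank F V)) F →ₐ[F] Polynomial (p.AffineFunctionField hp hdim) :=
  aeval fun i => Polynomial.C (p.coordinate hp hdim i) + Polynomial.C (s i) * Polynomial.X

theorem coeff_zero_lineEval (f : MvPolynomial (Fin (Module.finrank F V)) F) :
    (p.lineEval hp hdim s f).coeff 0 = p.evalGeneric hp hdim f := by
  induction f using MvPolynomial.induction_on with
  | C c =>
    have : p.lineEval hp hdim s (C c) = Polynomial.C (algebraMap F _ c) :=
      (p.lineEval hp hdim s).commutes c
    rw [this, Polynomial.coeff_C_zero]
    exact ((p.evalGeneric hp hdim).commutes c).symm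
  | add f g hf hg => rw [map_add, map_add, Polynomial.coeff_add, hf, hg]
  | mul_X f i hf =>
    rw [map_mul, map_mul, Polynomial.mul_coeff_zero, hf]
    simp [lineEval, evalGeneric]

variable [CharP F 2]

instance : CharP (p.AffineFunctionField hp hdim) 2 :=
  charP_of_injective_algebraMap (algebraMap F (p.AffineFunctionField hp hdim)).injective 2

/-- In characteristic `2` the polynomial of `p` has no first-order term in any direction, so every
displacement stays on the cone to first order. -/
theorem displacement_polynomial : p.displacement hp hdim s p.polynomial = 0 := by
  have hsq : ∀ x t : p.AffineFunctionField hp hdim,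
      (TrivSqZeroExt.inl x + TrivSqZeroExt.inr t : DualNumber _) ^ 2 = TrivSqZeroExt.inl (x ^ 2) := by
    intro x t
    ext
    · simp
    · simp [sq, CharTwo.add_self_eq_zero, mul_comm]
  have hC : ∀ c, p.displacement hp hdim s (C c) = TrivSqZeroExt.inl (algebraMap F _ c) :=
    fun c => (p.displacement hp hdim s).commutes c
  have hX : ∀ i, p.displacement hp hdim s (X i)
      = TrivSqZeroExt.inl (p.coordinate hp hdim i) + TrivSqZeroExt.inr (s i) := fun i => aeval_X _ _
  simp only [polynomial, diagonalPolynomial, map_sum, map_mul, map_pow, hC, hX, hsq]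
  simp only [← TrivSqZeroExt.inl_mul]
  rw [← TrivSqZeroExt.inl_sum]
  exact congrArg TrivSqZeroExt.inl (p.sum_coeffs_mul_coordinate_sq hp hdim)

/-- The displacement by `s`, extended to the function field of the affine cone: it is well defined
modulo the polynomial of `p`, and elements outside the maximal ideal of the dual numbers are units. -/
noncomputable def displacementHom :
    p.AffineFunctionField hp hdim →+* DualNumber (p.AffineFunctionField hp hdim) :=
  IsLocalization.lift (M := nonZeroDivisors p.CoordinateRing)
    (g := Ideal.Quotient.lift (Ideal.span {p.polynomial}) (p.displacement hp hdim s).toRingHom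
      (by
        intro f hf
        obtain ⟨g, rfl⟩ := Ideal.mem_span_singleton.1 hf
        exact (map_mul (p.displacement hp hdim s) _ _).trans
          (by rw [displacement_polynomial, zero_mul])))
    (by
      rintro ⟨y, hy⟩
      let _ := p.isDomain_coordinateRing hp hdim
      obtain ⟨f, rfl⟩ := Ideal.Quotient.mk_surjective y
      rw [TrivSqZeroExt.isUnit_iff_isUnit_fst, isUnit_iff_ne_zero]
      change (p.displacement hp hdim s f).fst ≠ 0
      rw [fst_displacement, evalGeneric_eq]
      exact IsFractionRing.to_map_ne_zero_of_mem_nonZeroDivisors hy)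

theorem displacementHom_evalGeneric (f : MvPolynomial (Fin (Module.finrank F V)) F) :
    p.displacementHom hp hdim s (p.evalGeneric hp hdim f) = p.displacement hp hdim s f := by
  rw [evalGeneric_eq, displacementHom, IsLocalization.lift_eq]
  rfl

theorem fst_displacementHom (z : p.AffineFunctionField hp hdim) :
    (p.displacementHom hp hdim s z).fst = z := by
  have h : ((TrivSqZeroExt.fstHom F (p.AffineFunctionField hp hdim) _).toRingHom).comp
      (p.displacementHom hp hdim s) = RingHom.id _ := by
    refine IsLocalization.ringHom_ext (nonZeroDivisors p.CoordinateRing) ?_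
    refine Ideal.Quotient.ringHom_ext (RingHom.ext fun f => ?_)
    change (p.displacementHom hp hdim s
      (algebraMap p.CoordinateRing (p.AffineFunctionField hp hdim) (Ideal.Quotient.mk _ f))).fst = _
    rw [← evalGeneric_eq, displacementHom_evalGeneric, fst_displacement, evalGeneric_eq]
    rfl
  exact DFunLike.congr_fun h z

/-- The derivation `D_s` over `F` of the function field of the affine cone with `D_s x i = s i`. -/
noncomputable def coneDerivation :
    Derivation F (p.AffineFunctionField hp hdim) (p.AffineFunctionField hp hdim) :=
  Derivation.mk'
    { toFun := fun z => (p.displacementHom hp hdim s z).snd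
      map_add' := fun y z => by rw [map_add, TrivSqZeroExt.snd_add]
      map_smul' := fun c z => by
        have h : p.displacementHom hp hdim s (algebraMap F _ c)
            = TrivSqZeroExt.inl (algebraMap F _ c) := by
          rw [← (p.evalGeneric hp hdim).commutes, displacementHom_evalGeneric, AlgHom.commutes,
            AlgHom.commutes]
          rfl
        rw [Algebra.smul_def, map_mul, h]
        simp [Algebra.smul_def] }
    fun y z => by
      simp only [LinearMap.coe_mk, AddHom.coe_mk]
      rw [map_mul, TrivSqZeroExt.snd_mul, fst_displacementHom, fst_displacementHom]
      simp [add_comm, mul_comm]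

theorem coneDerivation_evalGeneric (f : MvPolynomial (Fin (Module.finrank F V)) F) :
    p.coneDerivation hp hdim s (p.evalGeneric hp hdim f) = (p.displacement hp hdim s f).snd := by
  rw [← displacementHom_evalGeneric]
  rfl

theorem coneDerivation_coordinate (i : Fin (Module.finrank F V)) :
    p.coneDerivation hp hdim s (p.coordinate hp hdim i) = s i := by
  have h := p.coneDerivation_evalGeneric hp hdim s (X i)
  simpa [evalGeneric, displacement] using h

theorem coeff_one_lineEval (f : MvPolynomial (Fin (Module.finrank F V)) F) :
    (p.lineEval hp hdim s f).coeff 1 = p.coneDerivation hp hdim s (p.evalGeneric hp hdim f) := by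
  induction f using MvPolynomial.induction_on with
  | C c =>
    have h : p.lineEval hp hdim s (C c) = Polynomial.C (algebraMap F _ c) :=
      (p.lineEval hp hdim s).commutes c
    have h' : p.evalGeneric hp hdim (C c) = algebraMap F _ c :=
      (p.evalGeneric hp hdim).commutes c
    rw [h, h', Polynomial.coeff_C_succ, Derivation.map_algebraMap]
  | add f g hf hg => rw [map_add, map_add, map_add, Polynomial.coeff_add, hf, hg]
  | mul_X f i hf =>
    have h : p.evalGeneric hp hdim (X i) = p.coordinate hp hdim i := aeval_X _ _
    rw [map_mul, map_mul, Polynomial.mul_coeff_one, hf, coeff_zero_lineEval, Derivation.leibniz, h,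
      coneDerivation_coordinate]
    simp [lineEval]
    ring

/-- `p (x + Y s) = p s * Y ^ 2`, since `p` is additive and `p x = 0`. -/
theorem lineEval_polynomial : p.lineEval hp hdim s p.polynomial
    = Polynomial.C (∑ i, algebraMap F _ (p.coeffs i) * s i ^ 2) * Polynomial.X ^ 2 := by
  have hC : ∀ c, p.lineEval hp hdim s (C c) = Polynomial.C (algebraMap F _ c) :=
    fun c => (p.lineEval hp hdim s).commutes c
  have hX : ∀ i, p.lineEval hp hdim s (X i)
      = Polynomial.C (p.coordinate hp hdim i) + Polynomial.C (s i) * Polynomial.X :=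
    fun i => aeval_X _ _
  have h0 := congrArg Polynomial.C (p.sum_coeffs_mul_coordinate_sq hp hdim)
  rw [map_zero, map_sum] at h0
  rw [polynomial, diagonalPolynomial, map_sum, map_sum, Finset.sum_mul, ← sub_eq_zero,
    ← Finset.sum_sub_distrib, ← h0]
  refine Finset.sum_congr rfl fun i _ => ?_
  rw [map_mul, map_pow, hC, hX, CharTwo.add_sq]
  simp only [map_mul, map_pow, coeffs]
  ring

/-- The second-order coefficient of `q (f (x + Y s)) = p (x + Y s) * h (x + Y s)`. -/
theorem sum_mul_coneDerivation_sq_of_eq {ι : Type*} [Fintype ι] (b : ι → F)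
    (f : ι → MvPolynomial (Fin (Module.finrank F V)) F)
    (h : MvPolynomial (Fin (Module.finrank F V)) F)
    (hf : ∑ j, C (b j) * f j ^ 2 = p.polynomial * h) :
    ∑ j, algebraMap F _ (b j) * p.coneDerivation hp hdim s (p.evalGeneric hp hdim (f j)) ^ 2
      = (∑ i, algebraMap F _ (p.coeffs i) * s i ^ 2) * p.evalGeneric hp hdim h := by
  have h2 : (p.lineEval hp hdim s _).coeff 2 = (p.lineEval hp hdim s _).coeff 2 :=
    congrArg (fun g => (p.lineEval hp hdim s g).coeff 2) hf
  have hC : ∀ c, p.lineEval hp hdim s (C c) = Polynomial.C (algebraMap F _ c) :=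
    fun c => (p.lineEval hp hdim s).commutes c
  have hsq : ∀ g : Polynomial (p.AffineFunctionField hp hdim), (g ^ 2).coeff 2 = g.coeff 1 ^ 2 := by
    intro g
    have h2 : (2 : p.AffineFunctionField hp hdim) = 0 := CharTwo.two_eq_zero
    rw [sq, Polynomial.coeff_mul]
    have ha : (Finset.HasAntidiagonal.antidiagonal 2 : Finset (ℕ × ℕ)) = {(0, 2), (1, 1), (2, 0)} := rfl
    simp only [ha, Finset.sum_insert, Finset.mem_insert, Finset.mem_singleton, Prod.mk.injEq,
      OfNat.ofNat_ne_zero, OfNat.zero_ne_ofNat, zero_ne_one, one_ne_zero, false_and, and_false, or_self,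
      not_false_eq_true, Finset.sum_singleton, OfNat.one_ne_ofNat]
    linear_combination (g.coeff 0 * g.coeff 2) * h2
  rw [map_mul, lineEval_polynomial, map_sum, Polynomial.finsetSum_coeff] at h2
  simp only [map_mul, map_pow, hC, Polynomial.coeff_C_mul, hsq, coeff_one_lineEval] at h2
  rw [h2, mul_assoc, Polynomial.coeff_C_mul, ← coeff_zero_lineEval p hp hdim s h]
  congr 1
  simpa using Polynomial.coeff_X_pow_mul (p.lineEval hp hdim s h) 2 0

/-- An isotropic vector `w` of the diagonal form `q = ∑ b j X j ^ 2` over the function field of the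
cone `p = 0` has a residue `h`, nonzero if `w` is, with `q (D_s w) = p s * h` for every direction
`s`. -/
theorem exists_forall_sum_mul_coneDerivation_sq {ι : Type*} [Fintype ι] {b : ι → F}
    (hb : ∀ c : ι → F, ∑ j, b j * c j ^ 2 = 0 → c = 0) {w : ι → p.AffineFunctionField hp hdim}
    (hw : ∑ j, algebraMap F _ (b j) * w j ^ 2 = 0) :
    ∃ h : p.AffineFunctionField hp hdim,
      (∀ s, ∑ j, algebraMap F _ (b j) * p.coneDerivation hp hdim s (w j) ^ 2
        = (∑ i, algebraMap F _ (p.coeffs i) * s i ^ 2) * h) ∧ (h = 0 → ∀ j, w j = 0) := by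
  obtain ⟨d, f, hd, hf⟩ := p.exists_common_denominator hp hdim w
  have hdvd : p.polynomial ∣ ∑ j, C (b j) * f j ^ 2 := by
    rw [← p.evalGeneric_eq_zero_iff hp hdim]
    have hC : ∀ c, p.evalGeneric hp hdim (C c) = algebraMap F _ c :=
      fun c => (p.evalGeneric hp hdim).commutes c
    simp only [map_sum, map_mul, map_pow, hC, hf, mul_pow, mul_left_comm _ (d ^ 2)]
    rw [← Finset.mul_sum, hw, mul_zero]
  obtain ⟨g, hg⟩ := hdvd
  -- The residue of `d • w` is the value of `g`; passing from `d • w` to `w` divides it by `d ^ 2`.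
  refine ⟨p.evalGeneric hp hdim g / d ^ 2, fun s => ?_, fun h j => ?_⟩
  · have h1 := p.sum_mul_coneDerivation_sq_of_eq hp hdim s b f g hg
    rw [← mul_div_assoc, eq_div_iff (pow_ne_zero 2 hd), ← h1, Finset.sum_mul, ← add_zero (∑ j, _),
      ← zero_mul (p.coneDerivation hp hdim s d ^ 2), ← hw, Finset.sum_mul,
      ← Finset.sum_add_distrib]
    refine Finset.sum_congr rfl fun j _ => ?_
    rw [hf, Derivation.leibniz, CharTwo.add_sq, smul_eq_mul, smul_eq_mul]
    ring
  · rw [div_eq_zero_iff, or_iff_left (pow_ne_zero 2 hd), evalGeneric_eq_zero_iff] at h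
    obtain ⟨k, rfl⟩ := h
    have h2 : p.polynomial ∣ f j := dvd_of_sq_dvd_sum_C_mul_sq (by omega) (p.coeffs_ne_zero hp) hb
      (by rw [← polynomial_eq, hg, sq, ← mul_assoc]; exact dvd_mul_right _ _) j
    rw [← p.evalGeneric_eq_zero_iff hp hdim, hf] at h2
    exact (mul_eq_zero.1 h2).resolve_left hd

end Deformation

/-! ### Values, subforms and scalar extension of quasilinear forms -/

section General

variable {K : Type*} {S S' : Type*} [Field K] [AddCommGroup S] [Module K S] [AddCommGroup S']
  [Module K S']

/-- The pullback of a quasilinear form along a linear map. -/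
def comp (q : QuasilinearForm K S) (f : S' →ₗ[K] S) : QuasilinearForm K S' :=
  ofAddMonoidHom (q.toAddMonoidHom.comp f.toAddMonoidHom) fun a v => by
    change q.toQuadraticMap (f (a • v)) = a * a * q.toQuadraticMap (f v)
    rw [map_smul, smul_apply]

theorem Anisotropic.injective {q : QuasilinearForm K S} (hq : q.Anisotropic) :
    Function.Injective q.toQuadraticMap :=
  (injective_iff_map_eq_zero q.toAddMonoidHom).2 hq

/-- For anisotropic quasilinear forms, being a subform only depends on the sets of values. -/
theorem isSubform_of_forall_exists [FiniteDimensional K S'] {p : QuasilinearForm K S}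
    {q : QuasilinearForm K S'} (hp : p.Anisotropic) (hq : q.Anisotropic)
    (h : ∀ v, ∃ w, q.toQuadraticMap w = p.toQuadraticMap v) : p.IsSubform q := by
  choose f hf using h
  let g : S →ₗ[K] S' :=
    { toFun := f
      map_add' := fun v w => hq.injective (by rw [add_apply, hf, hf, hf, add_apply])
      map_smul' := fun a v => hq.injective (by
        rw [RingHom.id_apply, smul_apply, hf, hf, smul_apply]) }
  have hg : ∀ v, q.toQuadraticMap (g v) = p.toQuadraticMap v := hf
  have hinj : Function.Injective g := fun v w hvw => hp.injective (by rw [← hg, hvw, hg])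
  obtain ⟨C, hC⟩ := Submodule.exists_isCompl (LinearMap.range g)
  let e : (Fin (Module.finrank K C) → K) ≃ₗ[K] C := (Module.finBasis K C).equivFun.symm
  refine ⟨Module.finrank K C, (q.comp (C.subtype ∘ₗ e.toLinearMap)).toQuadraticMap,
    ⟨QuadraticMap.IsometryEquiv.symm
      { toLinearEquiv := ((LinearEquiv.ofInjective g hinj).prodCongr e).trans
          (Submodule.prodEquivOfIsCompl _ _ hC)
        map_app' := fun x => ?_ }⟩⟩
  change q.toQuadraticMap (g x.1 + e x.2) = p.toQuadraticMap x.1 + q.toQuadraticMap (e x.2)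
  rw [add_apply, hg]

/-- The values of a tensor product are sums of products of values. -/
theorem exists_eq_tensor_apply {U : Type*} [AddCommGroup U] [Module K U]
    {p : QuasilinearForm K S} {q : QuasilinearForm K S'} {r : QuasilinearForm K U}
    (h : ∀ v w, ∃ u, r.toQuadraticMap u = p.toQuadraticMap v * q.toQuadraticMap w)
    (t : S ⊗[K] S') : ∃ u, r.toQuadraticMap u = (p.tensor q).toQuadraticMap t := by
  induction t with
  | zero => exact ⟨0, by rw [QuadraticMap.map_zero, QuadraticMap.map_zero]⟩
  | tmul v w => exact h v w
  | add s t hs ht =>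
    obtain ⟨x, hx⟩ := hs
    obtain ⟨y, hy⟩ := ht
    exact ⟨x + y, by rw [add_apply, add_apply, hx, hy]⟩

theorem baseChange_sum_tmul {F : Type*} {V : Type*} [Field F] [AddCommGroup V] [Module F V]
    (q : QuasilinearForm F V) (L : Type*) [Field L] [Algebra F L] {ι : Type*} [Fintype ι]
    (l : ι → L) (v : ι → V) : (q.baseChange L).toQuadraticMap (∑ j, l j ⊗ₜ[F] v j)
      = ∑ j, algebraMap F L (q.toQuadraticMap (v j)) * l j ^ 2 := by
  rw [sum_apply]
  exact Finset.sum_congr rfl fun j _ => by rw [baseChange_tmul, sq, mul_comm]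

theorem exists_sum_tmul_finBasis {F : Type*} {V : Type*} [Field F] [AddCommGroup V] [Module F V]
    [FiniteDimensional F V] (L : Type*) [Field L] [Algebra F L] (t : L ⊗[F] V) :
    ∃ l : Fin (Module.finrank F V) → L, t = ∑ j, l j ⊗ₜ[F] Module.finBasis F V j := by
  refine ⟨fun j => ((Module.finBasis F V).baseChange L).repr t j, ?_⟩
  conv_lhs => rw [← ((Module.finBasis F V).baseChange L).sum_repr t]
  simp [Module.Basis.baseChange_apply, TensorProduct.smul_tmul']

theorem eq_zero_of_sum_mul_sq_eq_zero {F : Type*} {V : Type*} [Field F] [AddCommGroup V] [Module F V]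
    [FiniteDimensional F V] {q : QuasilinearForm F V} (hq : q.Anisotropic)
    (c : Fin (Module.finrank F V) → F)
    (h : ∑ j, q.toQuadraticMap (Module.finBasis F V j) * c j ^ 2 = 0) : c = 0 := by
  have h1 : q.toQuadraticMap (∑ j, c j • Module.finBasis F V j) = 0 := by
    rw [sum_apply, ← h]
    exact Finset.sum_congr rfl fun j _ => by rw [smul_apply]; ring
  exact funext (Fintype.linearIndependent_iff.1 (Module.finBasis F V).linearIndependent c (hq _ h1))

theorem sum_mul_single_sq {n : ℕ} (a : Fin n → K) (i : Fin n) :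
    ∑ k, a k * (Pi.single i 1 : Fin n → K) k ^ 2 = a i := by
  rw [Finset.sum_eq_single i (fun k _ hk => by simp [Pi.single_eq_of_ne hk]) (by simp)]
  simp

theorem baseChange_self_anisotropic {F V : Type*} [Field F] [AddCommGroup V] [Module F V]
    [FiniteDimensional F V] {q : QuasilinearForm F V} (hq : q.Anisotropic) :
    (q.baseChange F).Anisotropic := by
  intro t ht
  obtain ⟨l, rfl⟩ := exists_sum_tmul_finBasis F t
  rw [baseChange_sum_tmul] at ht
  simp [eq_zero_of_sum_mul_sq_eq_zero hq l ht]

theorem rTensor_derivation_smul {F W : Type*} [Field F] [AddCommGroup W] [Module F W]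
    {L : Type*} [Field L] [Algebra F L] (D : Derivation F L L) (c : L)
    (t : L ⊗[F] W) : D.toLinearMap.rTensor W (c • t)
      = c • D.toLinearMap.rTensor W t + D c • t := by
  induction t with
  | zero => simp
  | tmul l w =>
    simp only [TensorProduct.smul_tmul', LinearMap.rTensor_tmul, ← TensorProduct.add_tmul]
    congr 1
    simp [mul_comm]
  | add s t hs ht => rw [smul_add, map_add, map_add, hs, ht, smul_add, smul_add]; abel

/-- For an isotropic vector `t`, the term `D c • t` in the Leibniz rule does not contribute: although
`D` is not linear, `t ↦ q (D t)` is homogeneous of degree `2` on isotropic vectors. -/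
theorem baseChange_rTensor_derivation_smul {F W : Type*} [Field F] [AddCommGroup W] [Module F W]
    (q : QuasilinearForm F W) {L : Type*} [Field L] [Algebra F L]
    (D : Derivation F L L) (c : L) {t : L ⊗[F] W} (ht : (q.baseChange L).toQuadraticMap t = 0) :
    (q.baseChange L).toQuadraticMap (D.toLinearMap.rTensor W (c • t))
      = c * c * (q.baseChange L).toQuadraticMap (D.toLinearMap.rTensor W t) := by
  rw [rTensor_derivation_smul, add_apply, smul_apply, smul_apply, ht, mul_zero, add_zero]

/-- A form on the isotropic subspace of `q` whose values multiply values of `p` into values of `q`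
yields a form with the dimension and the subform property required of `τ`. It is transported to a
coordinate space to land in the universe of `K`. -/
theorem exists_tensor_anisotropicPart_isSubform {K : Type u} {S : Type v} {S' : Type w} [Field K]
    [AddCommGroup S] [Module K S] [AddCommGroup S'] [Module K S'] [FiniteDimensional K S']
    {p : QuasilinearForm K S} {q : QuasilinearForm K S'}
    (σ : QuasilinearForm K q.isotropicSubspace) (hσ : σ.Anisotropic)
    (h : ∀ v t, ∃ u, q.toQuadraticMap u = p.toQuadraticMap v * σ.toQuadraticMap t) :
    ∃ (T : Type u) (_ : AddCommGroup T) (_ : Module K T) (_ : FiniteDimensional K T)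
      (τ : QuasilinearForm K T), τ.Anisotropic ∧ Module.finrank K T = q.isotropyIndex ∧
        (p.anisotropicPart.tensor τ).anisotropicPart.IsSubform q.anisotropicPart := by
  let e := (Module.finBasis K q.isotropicSubspace).equivFun.symm
  refine ⟨Fin (Module.finrank K q.isotropicSubspace) → K, inferInstance, inferInstance,
    inferInstance, σ.comp e.toLinearMap, fun c hc => ?_, ?_, ?_⟩
  · exact (LinearEquiv.map_eq_zero_iff e).1 (hσ (e c) hc)
  · rw [isotropyIndex_eq, Module.finrank_fin_fun]
  · refine isSubform_of_forall_exists (anisotropicPart_anisotropic _)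
      (anisotropicPart_anisotropic _) fun x => ?_
    obtain ⟨x, rfl⟩ := Submodule.mkQ_surjective _ x
    refine exists_eq_tensor_apply (fun y c => ?_) x
    obtain ⟨v, rfl⟩ := Submodule.mkQ_surjective _ y
    obtain ⟨u, hu⟩ := h v (e c)
    exact ⟨Submodule.Quotient.mk u, hu⟩

end General

/-! ### Derivations of the function field of the quadric -/

section FunctionField

variable {F : Type u} {V : Type v} [Field F] [AddCommGroup V] [Module F V] [FiniteDimensional F V]
  (p : QuasilinearForm F V) (hp : p.Anisotropic) (hdim : 2 ≤ Module.finrank F V) [CharP F 2]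

/-- The derivation `D_s` lowers the degree by one when `s` is homogeneous of degree `0`; after scaling
`s` by a coordinate it preserves the degree, and hence the function field of the quadric. -/
theorem coneDerivation_mem_functionField (i₀ : Fin (Module.finrank F V))
    (s : Fin (Module.finrank F V) → p.functionField hp hdim) {z : p.AffineFunctionField hp hdim}
    (hz : z ∈ p.functionField hp hdim) :
    p.coneDerivation hp hdim (fun i => p.coordinate hp hdim i₀ * s i) z
      ∈ p.functionField hp hdim := by
  have hratio : ∀ i j, p.coordinate hp hdim i / p.coordinate hp hdim j ∈ p.functionField hp hdim :=
    fun i j => IntermediateField.subset_adjoin _ _ ⟨i, j, rfl⟩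
  induction hz using IntermediateField.adjoin_induction with
  | mem z hz =>
    obtain ⟨i, j, rfl⟩ := hz
    have h0 := p.coordinate_ne_zero hp hdim j
    have h : p.coneDerivation hp hdim (fun i => p.coordinate hp hdim i₀ * s i)
        (p.coordinate hp hdim i / p.coordinate hp hdim j)
        = p.coordinate hp hdim i₀ / p.coordinate hp hdim j * (s i
          - p.coordinate hp hdim i / p.coordinate hp hdim j * s j) := by
      rw [Derivation.leibniz_div, coneDerivation_coordinate, coneDerivation_coordinate,
        smul_eq_mul, smul_eq_mul, smul_eq_mul]
      field_simp
    rw [h]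
    exact mul_mem (hratio _ _) (sub_mem (s i).2 (mul_mem (hratio _ _) (s j).2))
  | algebraMap c => rw [Derivation.map_algebraMap]; exact zero_mem _
  | add y z hy hz hy' hz' => rw [map_add]; exact add_mem hy' hz'
  | inv z hz hz' =>
    rw [Derivation.leibniz_inv, smul_eq_mul]
    exact mul_mem (neg_mem (pow_mem (inv_mem hz) 2)) hz'
  | mul y z hy hz hy' hz' =>
    rw [Derivation.leibniz]
    exact add_mem (mul_mem hy hz') (mul_mem hz hy')

/-- The derivation of `F(p)` over `F` in the direction `s`, namely the restriction of `D_{x s}`, where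
`x` is the `i₀`-th coordinate of the generic point of the cone. -/
noncomputable def quadricDerivation (i₀ : Fin (Module.finrank F V))
    (s : Fin (Module.finrank F V) → p.functionField hp hdim) :
    Derivation F (p.functionField hp hdim) (p.functionField hp hdim) :=
  Derivation.mk'
    { toFun := fun z => ⟨_, p.coneDerivation_mem_functionField hp hdim i₀ s z.2⟩
      map_add' := fun _ _ => Subtype.ext (map_add (p.coneDerivation hp hdim _) _ _)
      map_smul' := fun c z => Subtype.ext ((p.coneDerivation hp hdim _).map_smul c z.1) }
    fun y z => Subtype.ext ((p.coneDerivation hp hdim _).leibniz y.1 z.1)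

/-- The analogue over `F(p)` of `exists_forall_sum_mul_coneDerivation_sq`. -/
theorem exists_forall_sum_mul_quadricDerivation_sq (i₀ : Fin (Module.finrank F V))
    {ι : Type*} [Fintype ι] {b : ι → F}
    (hb : ∀ c : ι → F, ∑ j, b j * c j ^ 2 = 0 → c = 0) {w : ι → p.functionField hp hdim}
    (hw : ∑ j, algebraMap F (p.functionField hp hdim) (b j) * w j ^ 2 = 0) :
    ∃ h : p.functionField hp hdim,
      (∀ s, ∑ j, algebraMap F _ (b j) * p.quadricDerivation hp hdim i₀ s (w j) ^ 2
        = (∑ i, algebraMap F _ (p.coeffs i) * s i ^ 2) * h) ∧ (h = 0 → ∀ j, w j = 0) := by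
  have hw' : ∑ j, algebraMap F (p.AffineFunctionField hp hdim) (b j)
      * (w j : p.AffineFunctionField hp hdim) ^ 2 = 0 := by
    simpa using congrArg (algebraMap (p.functionField hp hdim) (p.AffineFunctionField hp hdim)) hw
  obtain ⟨h, h1, h2⟩ := p.exists_forall_sum_mul_coneDerivation_sq hp hdim hb hw'
  set x := p.coordinate hp hdim i₀ with hx
  have hx0 : x ≠ 0 := p.coordinate_ne_zero hp hdim i₀
  have h3 : ∀ s : Fin (Module.finrank F V) → p.functionField hp hdim,
      algebraMap (p.functionField hp hdim) (p.AffineFunctionField hp hdim)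
        (∑ j, algebraMap F _ (b j) * p.quadricDerivation hp hdim i₀ s (w j) ^ 2)
      = algebraMap (p.functionField hp hdim) (p.AffineFunctionField hp hdim)
        (∑ i, algebraMap F _ (p.coeffs i) * s i ^ 2) * (x ^ 2 * h) := by
    intro s
    have h4 := h1 fun i => x * s i
    simp only [mul_pow, mul_left_comm _ (x ^ 2)] at h4
    rw [← Finset.mul_sum, mul_comm (x ^ 2), mul_assoc] at h4
    simp only [map_sum, map_mul, map_pow]
    exact h4
  -- The displacement in the direction of a coordinate axis shows that `x ^ 2 * h` has degree zero.
  have hmem : x ^ 2 * h ∈ p.functionField hp hdim := by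
    have ha : algebraMap (p.functionField hp hdim) (p.AffineFunctionField hp hdim)
        (algebraMap F _ (p.coeffs i₀)) ≠ 0 := by
      rw [Ne, map_eq_zero, map_eq_zero]
      exact p.coeffs_ne_zero hp i₀
    have h4 := h3 (Pi.single i₀ 1)
    rw [sum_mul_single_sq, mul_comm, ← div_eq_iff ha, ← map_div₀] at h4
    exact h4 ▸ (_ / _ : p.functionField hp hdim).2
  refine ⟨⟨x ^ 2 * h, hmem⟩, fun s => ?_, fun h0 j => ?_⟩
  · apply (algebraMap (p.functionField hp hdim) (p.AffineFunctionField hp hdim)).injective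
    rw [h3, map_mul]
    rfl
  · have h4 : x ^ 2 * h = 0 := congrArg Subtype.val h0
    exact Subtype.ext (h2 ((mul_eq_zero.1 h4).resolve_left (pow_ne_zero 2 hx0)) j)

end FunctionField

/-! ### The residue form -/

section ResidueForm

variable {F : Type u} {V : Type v} {W : Type w} [Field F] [AddCommGroup V] [Module F V]
  [FiniteDimensional F V] [AddCommGroup W] [Module F W]
  (p : QuasilinearForm F V) (hp : p.Anisotropic) (hdim : 2 ≤ Module.finrank F V) [CharP F 2]
  (q : QuasilinearForm F W)

/-- The residue form of `q` along `p`, defined on the space of isotropic vectors of `q` over `F(p)`.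
Its value at `t` is the residue `h` with `q (D_s t) = p s * h` for all `s`; it is defined here by means
of the basis direction `s = e_{i₀}`, for which `p s` is the coefficient `p.coeffs i₀ ≠ 0`. -/
noncomputable def residueForm (i₀ : Fin (Module.finrank F V)) :
    QuasilinearForm (p.functionField hp hdim)
      (q.baseChange (p.functionField hp hdim)).isotropicSubspace :=
  ofAddMonoidHom
    (((AddMonoidHom.mulLeft (algebraMap F (p.functionField hp hdim) (p.coeffs i₀))⁻¹).comp
      (q.baseChange (p.functionField hp hdim)).toAddMonoidHom).comp
      (((p.quadricDerivation hp hdim i₀ (Pi.single i₀ 1)).toLinearMap.rTensor W).toAddMonoidHom.comp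
        (q.baseChange (p.functionField hp hdim)).isotropicSubspace.subtype.toAddMonoidHom))
    fun c t => by
      have h := q.baseChange_rTensor_derivation_smul
        (p.quadricDerivation hp hdim i₀ (Pi.single i₀ 1)) c t.2
      exact (congrArg _ h).trans (mul_left_comm _ _ _)

theorem residueForm_apply (i₀ : Fin (Module.finrank F V))
    (t : (q.baseChange (p.functionField hp hdim)).isotropicSubspace) :
    (p.residueForm hp hdim q i₀).toQuadraticMap t
      = (algebraMap F (p.functionField hp hdim) (p.coeffs i₀))⁻¹
        * (q.baseChange (p.functionField hp hdim)).toQuadraticMap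
          ((p.quadricDerivation hp hdim i₀ (Pi.single i₀ 1)).toLinearMap.rTensor W t.1) := rfl

variable [FiniteDimensional F W]

/-- The residue form is anisotropic, and its value at `t` is the residue of `t` in every direction. -/
theorem residueForm_spec (hq : q.Anisotropic) (i₀ : Fin (Module.finrank F V))
    (t : (q.baseChange (p.functionField hp hdim)).isotropicSubspace) :
    (∀ s, (q.baseChange (p.functionField hp hdim)).toQuadraticMap
          ((p.quadricDerivation hp hdim i₀ s).toLinearMap.rTensor W t.1)
        = (∑ i, algebraMap F _ (p.coeffs i) * s i ^ 2)
          * (p.residueForm hp hdim q i₀).toQuadraticMap t) ∧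
      ((p.residueForm hp hdim q i₀).toQuadraticMap t = 0 → t = 0) := by
  obtain ⟨t, ht⟩ := t
  obtain ⟨l, rfl⟩ := exists_sum_tmul_finBasis (p.functionField hp hdim) t
  have hl : (q.baseChange (p.functionField hp hdim)).toQuadraticMap
    (∑ j, l j ⊗ₜ[F] Module.finBasis F W j) = 0 := ht
  rw [baseChange_sum_tmul] at hl
  obtain ⟨h, h1, h2⟩ := p.exists_forall_sum_mul_quadricDerivation_sq hp hdim i₀
    (eq_zero_of_sum_mul_sq_eq_zero hq) hl
  have h3 : ∀ s, (q.baseChange (p.functionField hp hdim)).toQuadraticMap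
      ((p.quadricDerivation hp hdim i₀ s).toLinearMap.rTensor W
        (∑ j, l j ⊗ₜ[F] Module.finBasis F W j))
      = (∑ i, algebraMap F _ (p.coeffs i) * s i ^ 2) * h := by
    intro s
    rw [← h1, map_sum]
    simp only [LinearMap.rTensor_tmul]
    exact baseChange_sum_tmul _ _ _ _
  have h4 : (p.residueForm hp hdim q i₀).toQuadraticMap ⟨_, ht⟩ = h := by
    rw [residueForm_apply, h3, sum_mul_single_sq, inv_mul_cancel_left₀]
    rw [Ne, map_eq_zero]
    exact p.coeffs_ne_zero hp i₀
  rw [h4]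
  refine ⟨h3, fun h0 => Subtype.ext ?_⟩
  simp [h2 h0]

theorem exists_eq_baseChange_mul_residueForm (hq : q.Anisotropic) (i₀ : Fin (Module.finrank F V))
    (v : p.functionField hp hdim ⊗[F] V)
    (t : (q.baseChange (p.functionField hp hdim)).isotropicSubspace) :
    ∃ u, (q.baseChange (p.functionField hp hdim)).toQuadraticMap u
      = (p.baseChange (p.functionField hp hdim)).toQuadraticMap v
        * (p.residueForm hp hdim q i₀).toQuadraticMap t := by
  obtain ⟨s, rfl⟩ := exists_sum_tmul_finBasis (p.functionField hp hdim) v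
  refine ⟨_, ((p.residueForm_spec hp hdim q hq i₀ t).1 s).trans ?_⟩
  rw [baseChange_sum_tmul]
  rfl

/-- The form `τ` exists over `F(p)` itself, for all anisotropic `p` of dimension at least `2` and all
anisotropic `q`. -/
theorem exists_tensor_firstKernel_isSubform (hq : q.Anisotropic) :
    ∃ (T : Type u) (_ : AddCommGroup T) (_ : Module (p.functionField hp hdim) T)
      (_ : FiniteDimensional (p.functionField hp hdim) T)
      (τ : QuasilinearForm (p.functionField hp hdim) T),
      τ.Anisotropic ∧
      Module.finrank (p.functionField hp hdim) T
        = (q.baseChange (p.functionField hp hdim)).isotropyIndex ∧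
      ((p.firstKernel hp hdim).tensor τ).anisotropicPart.IsSubform
        (q.baseChange (p.functionField hp hdim)).anisotropicPart := by
  let i₀ : Fin (Module.finrank F V) := ⟨0, by omega⟩
  exact exists_tensor_anisotropicPart_isSubform (p.residueForm hp hdim q i₀)
    (fun t => (p.residueForm_spec hp hdim q hq i₀ t).2)
    (p.exists_eq_baseChange_mul_residueForm hp hdim q hq i₀)

end ResidueForm

end QuasilinearForm

/-! ### Existence of the form over the function field of the quadric -/

theorem isPurelyTranscendental_self (F : Type*) [Field F] : IsPurelyTranscendental F F :=
  ⟨∅, algebraicIndependent_empty_type, Subsingleton.elim _ _⟩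

theorem theorem6p3 {F : Type u} [Field F] [CharP F 2]
    {V : Type v} [AddCommGroup V] [Module F V] [FiniteDimensional F V]
    {W : Type w} [AddCommGroup W] [Module F W] [FiniteDimensional F W]
    (p : QuasilinearForm F V) (q : QuasilinearForm F W)
    (hp : p.Anisotropic) (hq : q.Anisotropic)
    (hpdim : 2 ≤ Module.finrank F V) (hqdim : 2 ≤ Module.finrank F W)
    (hiso : (q.baseChange (p.functionField hp hpdim)).Isotropic) :
    ∃ (E : Type u) (_ : Field E) (_ : Algebra F E) (_ : IsPurelyTranscendental F E)
      (hpE : (p.baseChange E).Anisotropic),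
      let hdimE := QuasilinearForm.two_le_finrank_baseChange hpdim E
      let K := (p.baseChange E).functionField hpE hdimE
      let p₁ := (p.baseChange E).firstKernel hpE hdimE
      let qK := (q.baseChange E).baseChange K
      ∃ (T : Type u) (_ : AddCommGroup T) (_ : Module K T) (_ : FiniteDimensional K T)
        (τ : QuasilinearForm K T),
        τ.Anisotropic ∧
        Module.finrank K T = qK.isotropyIndex ∧
        (p₁.tensor τ).anisotropicPart.IsSubform qK.anisotropicPart := by
  -- The extension of transcendence degree zero suffices: `τ` exists over `F(p)` already.
  refine ⟨F, inferInstance, inferInstance, isPurelyTranscendental_self F,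
    QuasilinearForm.baseChange_self_anisotropic hp, ?_⟩
  exact QuasilinearForm.exists_tensor_firstKernel_isSubform _ _ _ _
    (QuasilinearForm.baseChange_self_anisotropic hq)
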